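/- Let $F$ be a field of characteristic $0$ or $p>2$. A Lie-Yamaguti algebra over $F$ is an $F$-vector space $L$ with a bilinear operation $[-,-]$ and a trilinear operation $\langle -,-,-\rangle$ such that, for all $a,b,c,d,e\in L$, $$[a,a]=0,\qquad \langle a,a,b\rangle=0,\qquad \sum_{a,b,c}\big([[a,b],c]+\langle a,b,c\rangle\big)=0,\qquad \sum_{a,b,c}\langle [a,b],c,d\rangle=0,$$ $$\langle a,b,[c,d]\rangle=[\langle a,b,c\rangle,d]+[c,\langle a,b,d\rangle],$$ $$\langle a,b,\langle c,d,e\rangle\rangle=\langle\langle a,b,c\rangle,d,e\rangle+\langle c,\langle a,b,d\rangle,e\rangle+\langle c,d,\langle a,b,e\rangle\rangle,$$ where $\sum_{a,b,c}$ denotes the cyclic sum over $a,b,c$. Theorem. The bilinear operation of every Lie-Yamaguti algebra over $F$ satisfies the multilinear polynomial identity of degree 8 $$\sum_{\sigma\in S_8}\varepsilon(\sigma)\Big( [[[[a,b],c],[d,e]],[[f,g],h]] -\tfrac32[[[[a,b],c],[[d,e],f]],[g,h]] -[[[[[a,b],c],d],[e,f]],[g,h]] +[[[[[a,b],c],[d,e]],f],[g,h]]$$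 $$+2\,[[[[[a,b],c],d],[[e,f],g]],h] +3\,[[[[[a,b],c],[[d,e],f]],g],h] +2\,[[[[[[a,b],c],d],[e,f]],g],h] -2\,[[[[[[a,b],c],[d,e]],f],g],h]\Big)\equiv 0,$$ where $\sigma\in S_8$ permutes the eight variables $a,b,c,d,e,f,g,h$ and $\varepsilon(\sigma)$ is its sign. This identity is not a consequence of anticommutativity: the polynomial on the left does not lie in the T-ideal generated by $[x,x]$ in the free nonassociative $F$-algebra on countably many generators, that is, in the smallest ideal which contains $[x,x]$ and is stable under all substitutions of polynomials for the variables. -/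

import Mathlib

universe u v w

/-- A Lie-Yamaguti algebra over the field `F`. The bilinear operation `[a, b]` is the product
`a * b` of the nonassociative `F`-algebra `L` (the classes `NonUnitalNonAssocRing L`, `Module F L`,
`IsScalarTower F L L`, `SMulCommClass F L L` together say precisely that `L` is an `F`-vector space
with an `F`-bilinear product and nothing more); the trilinear operation `⟨a, b, c⟩` is
`triple a b c`. -/
class LieYamagutiAlgebra (F : Type u) (L : Type v) [Field F] [NonUnitalNonAssocRing L]
    [Module F L] [IsScalarTower F L L] [SMulCommClass F L L] where
  /-- The trilinear operation `⟨a, b, c⟩`. -/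
  triple : L →ₗ[F] L →ₗ[F] L →ₗ[F] L
  bracket_self : ∀ a : L, a * a = 0
  triple_self : ∀ a b : L, triple a a b = 0
  cyclic_bracket_triple : ∀ a b c : L,
    ((a * b) * c + triple a b c) + ((b * c) * a + triple b c a)
      + ((c * a) * b + triple c a b) = 0
  cyclic_triple_bracket : ∀ a b c d : L,
    triple (a * b) c d + triple (b * c) a d + triple (c * a) b d = 0
  triple_bracket : ∀ a b c d : L,
    triple a b (c * d) = triple a b c * d + c * triple a b d
  triple_triple : ∀ a b c d e : L,
    triple a b (triple c d e) =
      triple (triple a b c) d e + triple c (triple a b d) e + triple c d (triple a b e)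

namespace NonassocPolynomial

/-- A nonassociative polynomial `f` in variables indexed by `X` is a polynomial identity of the
nonassociative algebra `A` if it vanishes under every substitution of elements of `A` for the
variables. -/
def IsIdentity (F : Type u) [Field F] {X : Type w} (A : Type v) [NonUnitalNonAssocRing A]
    [Module F A] [IsScalarTower F A A] [SMulCommClass F A A]
    (f : FreeNonUnitalNonAssocAlgebra F X) : Prop :=
  ∀ a : X → A, FreeNonUnitalNonAssocAlgebra.lift F a f = 0

/-- `IsConsequence F S f`: the polynomial identity `f` is a consequence of the identities in `S`,
that is, `f` lies in the T-ideal generated by `S`, the smallest ideal of the free nonassociative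
algebra which contains `S` and is stable under all substitutions of polynomials for the
variables. -/
inductive IsConsequence (F : Type u) [Field F] {X : Type w}
    (S : Set (FreeNonUnitalNonAssocAlgebra F X)) : FreeNonUnitalNonAssocAlgebra F X → Prop
  | of_mem {f : FreeNonUnitalNonAssocAlgebra F X} : f ∈ S → IsConsequence F S f
  | zero : IsConsequence F S 0
  | add {f g : FreeNonUnitalNonAssocAlgebra F X} :
      IsConsequence F S f → IsConsequence F S g → IsConsequence F S (f + g)
  | smul (c : F) {f : FreeNonUnitalNonAssocAlgebra F X} :
      IsConsequence F S f → IsConsequence F S (c • f)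
  | mul_left (g : FreeNonUnitalNonAssocAlgebra F X) {f : FreeNonUnitalNonAssocAlgebra F X} :
      IsConsequence F S f → IsConsequence F S (g * f)
  | mul_right (g : FreeNonUnitalNonAssocAlgebra F X) {f : FreeNonUnitalNonAssocAlgebra F X} :
      IsConsequence F S f → IsConsequence F S (f * g)
  | subst (s : X → FreeNonUnitalNonAssocAlgebra F X) {f : FreeNonUnitalNonAssocAlgebra F X} :
      IsConsequence F S f → IsConsequence F S (FreeNonUnitalNonAssocAlgebra.lift F s f)

/-- The identity `[x, x] ≡ 0` of anticommutativity, as a polynomial in countably many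
variables. -/
noncomputable def anticommutativity (F : Type u) [Field F] : FreeNonUnitalNonAssocAlgebra F ℕ :=
  FreeNonUnitalNonAssocAlgebra.of F 0 * FreeNonUnitalNonAssocAlgebra.of F 0

/-- The combination of eight bracket monomials in `a, b, c, d, e, f, g, h`, where the bracket is the
product of the nonassociative algebra `A`. -/
def eightTerms (F : Type u) [Field F] {A : Type v} [NonUnitalNonAssocRing A] [Module F A]
    (a b c d e f g h : A) : A :=
  (((a * b) * c) * (d * e)) * ((f * g) * h)
  - (3 / 2 : F) • ((((a * b) * c) * ((d * e) * f)) * (g * h))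
  - ((((a * b) * c) * d) * (e * f)) * (g * h)
  + ((((a * b) * c) * (d * e)) * f) * (g * h)
  + (2 : F) • (((((a * b) * c) * d) * ((e * f) * g)) * h)
  + (3 : F) • (((((a * b) * c) * ((d * e) * f)) * g) * h)
  + (2 : F) • ((((((a * b) * c) * d) * (e * f)) * g) * h)
  - (2 : F) • ((((((a * b) * c) * (d * e)) * f) * g) * h)

/-- The multilinear polynomial of degree 8 in the variables `x 0, …, x 7`: the alternating sum of
`eightTerms` over all permutations of the eight variables. -/
noncomputable def degreeEight (F : Type u) [Field F] : FreeNonUnitalNonAssocAlgebra F ℕ :=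
  let x : Fin 8 → FreeNonUnitalNonAssocAlgebra F ℕ :=
    fun i => FreeNonUnitalNonAssocAlgebra.of F (i : ℕ)
  ∑ σ : Equiv.Perm (Fin 8), ((Equiv.Perm.sign σ : ℤ) : F) •
    eightTerms F (x (σ 0)) (x (σ 1)) (x (σ 2)) (x (σ 3)) (x (σ 4)) (x (σ 5)) (x (σ 6)) (x (σ 7))

end NonassocPolynomial

/-! An alternating sum of multilinear monomials in `a 0, …, a 7` is the top exterior coefficient of
the same expression with every variable equal to the odd element `x = ∑ eᵢ ⊗ aᵢ` of `Λ(F⁸) ⊗ L`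
(`sum_sign_smul_eightTerms`). That tensor product is a Lie-Yamaguti superalgebra
(`isLieYamagutiSuper_envelope`), so it suffices that `eightTerms` vanishes on one odd `x`
(`IsLieYamagutiSuper.eightTerms_eq_zero`).

Put `x2 = x * x` and `x3 = x2 * x`. The triples `T x2 x`, `T x2 x2` and `T x3 x` vanish, so the
cyclic identity writes `T x3 x2 x` and `T x3 x3 x` as products. The derivation rule then does the
same for `T x3 x3 x2` and `T x3 x2 x3`. Substituting these into the cyclic identity for `x3, x3, x2`
leaves a relation between products only, which is twice `eightTerms` up to sign.

For independence from anticommutativity, an anticommutative algebra is built along the tree of the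
first monomial, so that a single coordinate sees only that monomial. The alternating sum there is
`8`, one unit for each symmetry of the tree, and `8 ≠ 0` since the characteristic is not 2. -/

open scoped TensorProduct

/-! ### Graded commutativity of the exterior algebra -/

namespace ExteriorAlgebra

variable {R : Type*} {V : Type*} [CommRing R] [AddCommGroup V] [Module R V]

theorem ι_mul_of_mem_exteriorPower (m : V) {q : ℕ} {y : ExteriorAlgebra R V}
    (hy : y ∈ ⋀[R]^q V) : ι R m * y = (-1 : R) ^ q • (y * ι R m) := by
  induction hy using Submodule.pow_induction_on_left' with
  | algebraMap r => simp [Algebra.commutes]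
  | add x y i hx hy ihx ihy => rw [mul_add, add_mul, smul_add, ihx, ihy]
  | mem_mul n hn i x hx ih =>
    obtain ⟨n, rfl⟩ := hn
    have h : ι R m * ι R n = -(ι R n * ι R m) :=
      eq_neg_of_add_eq_zero_left (ι_add_mul_swap m n)
    rw [← mul_assoc, h, neg_mul, mul_assoc, ih, mul_smul_comm, mul_assoc, pow_succ, mul_neg_one,
      neg_smul]

theorem mul_comm_of_mem_exteriorPower {p q : ℕ} {x y : ExteriorAlgebra R V}
    (hx : x ∈ ⋀[R]^p V) (hy : y ∈ ⋀[R]^q V) : x * y = (-1 : R) ^ (p * q) • (y * x) := by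
  induction hx using Submodule.pow_induction_on_left' with
  | algebraMap r => simp [Algebra.commutes]
  | add x y i hx hy ihx ihy => rw [mul_add, add_mul, smul_add, ihx, ihy]
  | mem_mul n hn i x hx ih =>
    obtain ⟨n, rfl⟩ := hn
    rw [mul_assoc, ih, mul_smul_comm, ← mul_assoc, ι_mul_of_mem_exteriorPower n hy,
      smul_mul_assoc, smul_smul, mul_assoc, ← pow_add, Nat.succ_mul]

end ExteriorAlgebra

/-! ### Lie-Yamaguti superalgebras -/

/-- A trilinear operation `T` on an algebra graded by submodules `G p` which makes it a
Lie-Yamaguti superalgebra, apart from the identity on two successive triple products. -/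
structure IsLieYamagutiSuper {F : Type u} {A : Type v} [Field F] [NonUnitalNonAssocRing A]
    [Module F A] (G : ℕ → Submodule F A) (T : A →ₗ[F] A →ₗ[F] A →ₗ[F] A) : Prop where
  mul_mem {p q : ℕ} {u v : A} : u ∈ G p → v ∈ G q → u * v ∈ G (p + q)
  mul_anticomm {p q : ℕ} {u v : A} : u ∈ G p → v ∈ G q →
    u * v = -((-1 : F) ^ (p * q) • (v * u))
  triple_anticomm {p q : ℕ} {u v : A} : u ∈ G p → v ∈ G q → ∀ w,
    T u v w = -((-1 : F) ^ (p * q) • T v u w)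
  cyclic_mul_triple {p q r : ℕ} {u v w : A} : u ∈ G p → v ∈ G q → w ∈ G r →
    (u * v * w + T u v w) + (-1 : F) ^ (p * (q + r)) • (v * w * u + T v w u)
      + (-1 : F) ^ ((p + q) * r) • (w * u * v + T w u v) = 0
  cyclic_triple {p q r : ℕ} {u v w : A} : u ∈ G p → v ∈ G q → w ∈ G r → ∀ t,
    T (u * v) w t + (-1 : F) ^ (p * (q + r)) • T (v * w) u t
      + (-1 : F) ^ ((p + q) * r) • T (w * u) v t = 0
  triple_mul {p q r : ℕ} {u v w : A} : u ∈ G p → v ∈ G q → w ∈ G r → ∀ t,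
    T u v (w * t) = T u v w * t + (-1 : F) ^ ((p + q) * r) • (w * T u v t)
  -- `cyclic_triple` with three equal odd arguments yields only `3 • T (u * u) u t = 0`, which says
  -- nothing in characteristic 3.
  triple_mul_self_self {u : A} : u ∈ G 1 → ∀ t, T (u * u) u t = 0

theorem IsLieYamagutiSuper.eightTerms_eq_zero {F : Type u} {A : Type v} [Field F]
    [NonUnitalNonAssocRing A] [Module F A] [IsScalarTower F A A] [SMulCommClass F A A]
    {G : ℕ → Submodule F A} {T : A →ₗ[F] A →ₗ[F] A →ₗ[F] A} (H : IsLieYamagutiSuper G T)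
    (h2 : (2 : F) ≠ 0) {x : A} (hx : x ∈ G 1) :
    NonassocPolynomial.eightTerms F x x x x x x x x = 0 := by
  unfold NonassocPolynomial.eightTerms
  have m2 := H.mul_mem hx hx
  have m3 := H.mul_mem m2 hx
  set x2 := x * x with hx2
  set x3 := x2 * x with hx3
  have e₁ (t : A) : T x2 x t = 0 := H.triple_mul_self_self hx t
  have e₂ (t : A) : T x2 x2 t = 0 := by
    have h := H.triple_anticomm m2 m2 t
    norm_num [neg_smul] at h
    refine (smul_eq_zero_iff_right h2).1 ?_
    linear_combination (norm := module) h
  have a₁ : x * x2 = -x3 := by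
    have h := H.mul_anticomm hx m2
    norm_num [neg_smul] at h
    exact h
  have e₃ (t : A) : T x3 x t = 0 := by
    have h := H.cyclic_triple m2 hx hx t
    norm_num [← hx3, ← hx2, a₁, e₂, neg_smul] at h
    refine (smul_eq_zero_iff_right h2).1 ?_
    linear_combination (norm := module) h
  have e₄ (t : A) : T x x3 t = 0 := by
    rw [H.triple_anticomm hx m3, e₃]; simp
  have a₂ : x * x3 = x3 * x := by
    have h := H.mul_anticomm hx m3
    norm_num [neg_smul] at h
    exact h
  have a₃ : x2 * x3 = -(x3 * x2) := by
    have h := H.mul_anticomm m2 m3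
    norm_num [neg_smul] at h
    exact h
  have e₅ (t : A) : T x2 x3 t = -T x3 x2 t := by
    have h := H.triple_anticomm m2 m3 t
    norm_num [neg_smul] at h
    exact h
  -- In the cyclic identities behind `c₁` and `c₂`, the other two triples vanish by `e₁`, `e₃`,
  -- `e₄`.
  have c₁ : T x3 x2 x = x3 * x * x2 + x3 * x3 - x3 * x2 * x := by
    have h := H.cyclic_mul_triple m3 m2 hx
    norm_num [← hx3, e₁, e₄, a₂] at h
    linear_combination (norm := module) h
  have c₂ : T x3 x3 x = -(x3 * x3 * x) - (2 : F) • (x3 * x * x3) := by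
    have h := H.cyclic_mul_triple m3 m3 hx
    norm_num [e₃, e₄, a₂] at h
    linear_combination (norm := module) h
  -- The decisive relation: every triple in it will be rewritten through products of `x`.
  have c₃ := H.cyclic_mul_triple m3 m3 m2
  norm_num [e₅, a₃] at c₃
  have d₁ : T x3 x3 x2 = (2 : F) • (T x3 x3 x * x) := by
    have h := H.triple_mul m3 m3 hx x
    have h' : x * (x3 * x3 * x) = x3 * x3 * x * x := by
      have h := H.mul_anticomm hx (H.mul_mem (H.mul_mem m3 m3) hx)
      norm_num [neg_smul] at h
      exact h
    have h'' : x * (x3 * x * x3) = x3 * x * x3 * x := by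
      have h := H.mul_anticomm hx (H.mul_mem (H.mul_mem m3 hx) m3)
      norm_num [neg_smul] at h
      exact h
    norm_num [← hx2, c₂, mul_sub, mul_neg, mul_smul_comm, h', h''] at h
    rw [h, c₂]
    simp only [sub_mul, neg_mul, smul_mul_assoc]
    module
  have m6 : T x3 x2 x ∈ G 6 := by
    rw [c₁]
    exact sub_mem (add_mem (H.mul_mem (H.mul_mem m3 hx) m2)
      (H.mul_mem m3 m3)) (H.mul_mem (H.mul_mem m3 m2) hx)
  have q₁ : x * T x3 x2 x = -(T x3 x2 x * x) := by
    have h := H.mul_anticomm hx m6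
    norm_num [neg_smul] at h
    exact h
  have q₂ : x2 * T x3 x2 x = -(T x3 x2 x * x2) := by
    have h := H.mul_anticomm m2 m6
    norm_num [neg_smul] at h
    exact h
  have d₂ : T x3 x2 x2 = (2 : F) • (T x3 x2 x * x) := by
    have h := H.triple_mul m3 m2 hx x
    norm_num [← hx2, q₁] at h
    linear_combination (norm := module) h
  have d₃ : T x3 x2 x3 = (2 : F) • (T x3 x2 x * x * x) - T x3 x2 x * x2 := by
    have h := H.triple_mul m3 m2 m2 x
    norm_num [← hx3, q₂, d₂, smul_mul_assoc] at h
    linear_combination (norm := module) h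
  rw [d₁, d₃, c₁, c₂] at c₃
  simp only [add_mul, sub_mul, neg_mul, smul_mul_assoc] at c₃
  refine (smul_eq_zero_iff_right h2).1 ?_
  -- Doubling clears the coefficient `3 / 2`; the result is exactly the negative of `c₃`.
  have h32 : (2 : F) * (3 / 2) = 3 := mul_div_cancel₀ 3 h2
  simp only [smul_add, smul_sub, smul_smul, h32]
  linear_combination (norm := module) -c₃

/-! ### The Grassmann envelope of a Lie-Yamaguti algebra -/

namespace LieYamagutiAlgebra

variable {F : Type u} {V : Type w} {L : Type v} [Field F] [AddCommGroup V] [Module F V]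
  [NonUnitalNonAssocRing L] [Module F L]

local notation "Λ" => ExteriorAlgebra F V

/-- The elements of degree `p` of the tensor product of an exterior algebra with `L`. -/
def homogeneous (F : Type u) (V : Type w) (L : Type v) [Field F] [AddCommGroup V] [Module F V]
    [NonUnitalNonAssocRing L] [Module F L] (p : ℕ) : Submodule F (ExteriorAlgebra F V ⊗[F] L) :=
  Submodule.span F {u | ∃ x ∈ ⋀[F]^p V, ∃ a : L, x ⊗ₜ[F] a = u}

theorem tmul_mem_homogeneous {p : ℕ} {x : Λ} (hx : x ∈ ⋀[F]^p V) (a : L) :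
    x ⊗ₜ[F] a ∈ homogeneous F V L p :=
  Submodule.subset_span ⟨x, hx, a, rfl⟩

-- No scalar case is needed, because a scalar can be absorbed into the exterior factor of a pure
-- tensor.
@[elab_as_elim]
theorem homogeneous_induction {p : ℕ} {C : (u : Λ ⊗[F] L) → u ∈ homogeneous F V L p → Prop}
    (zero : C 0 (zero_mem _))
    (add : ∀ u v (hu : u ∈ homogeneous F V L p) (hv : v ∈ homogeneous F V L p),
      C u hu → C v hv → C (u + v) (add_mem hu hv))
    (tmul : ∀ x (hx : x ∈ ⋀[F]^p V) (a : L), C (x ⊗ₜ[F] a) (tmul_mem_homogeneous hx a))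
    {u : Λ ⊗[F] L} (hu : u ∈ homogeneous F V L p) : C u hu := by
  unfold homogeneous at hu
  induction hu using Submodule.closure_induction with
  | zero => exact zero
  | add u v hu hv ihu ihv => exact add u v hu hv ihu ihv
  | smul_mem c u hu =>
    obtain ⟨x, hx, a, rfl⟩ := hu
    exact tmul (c • x) (Submodule.smul_mem _ c hx) a

variable [IsScalarTower F L L] [SMulCommClass F L L]

theorem mul_mem_homogeneous {p q : ℕ} {u v : Λ ⊗[F] L} (hu : u ∈ homogeneous F V L p)
    (hv : v ∈ homogeneous F V L q) : u * v ∈ homogeneous F V L (p + q) := by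
  induction hu using homogeneous_induction with
  | zero => simp
  | add u₁ u₂ _ _ h₁ h₂ => rw [add_mul]; exact add_mem h₁ h₂
  | tmul x hx a =>
    induction hv using homogeneous_induction with
    | zero => simp
    | add v₁ v₂ _ _ h₁ h₂ => rw [mul_add]; exact add_mem h₁ h₂
    | tmul y hy b =>
      rw [Algebra.TensorProduct.tmul_mul_tmul]
      refine tmul_mem_homogeneous ?_ _
      unfold ExteriorAlgebra.exteriorPower
      rw [pow_add]
      exact Submodule.mul_mem_mul hx hy

variable [LieYamagutiAlgebra F L]

/-- The extension of the trilinear operation of `L` to the tensor product of an exterior algebra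
with `L`. -/
noncomputable def envelopeTriple (F : Type u) (V : Type w) (L : Type v) [Field F] [AddCommGroup V]
    [Module F V] [NonUnitalNonAssocRing L] [Module F L] [IsScalarTower F L L]
    [SMulCommClass F L L] [LieYamagutiAlgebra F L] :
    ExteriorAlgebra F V ⊗[F] L →ₗ[F] ExteriorAlgebra F V ⊗[F] L →ₗ[F]
      ExteriorAlgebra F V ⊗[F] L →ₗ[F] ExteriorAlgebra F V ⊗[F] L :=
  (TensorProduct.map₂ (LinearMap.mul F (ExteriorAlgebra F V)) (triple (F := F) (L := L))).compr₂
    (TensorProduct.map₂ (LinearMap.mul F (ExteriorAlgebra F V)) LinearMap.id)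

local notation "T" => envelopeTriple F V L

@[simp]
theorem envelopeTriple_tmul (x y z : Λ) (a b c : L) :
    T (x ⊗ₜ a) (y ⊗ₜ b) (z ⊗ₜ c) = (x * y * z) ⊗ₜ[F] triple (F := F) a b c := by
  simp [envelopeTriple, TensorProduct.map₂_apply_tmul]

/-! ### Super identities of the envelope -/

theorem mul_anticomm (F : Type u) [Field F] [Module F L] [IsScalarTower F L L]
    [SMulCommClass F L L] [LieYamagutiAlgebra F L] (a b : L) : a * b = -(b * a) := by
  have h := bracket_self (F := F) (a + b)
  rw [add_mul, mul_add, mul_add, bracket_self (F := F) a, bracket_self (F := F) b, zero_add,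
    add_zero] at h
  exact eq_neg_of_add_eq_zero_left h

theorem triple_anticomm (a b c : L) :
    triple (F := F) a b c = -triple (F := F) b a c := by
  have h := triple_self (F := F) (a + b) c
  simp only [map_add, LinearMap.add_apply, triple_self, zero_add, add_zero] at h
  exact eq_neg_of_add_eq_zero_right h

theorem homogeneous_mul_anticomm {p q : ℕ} {u v : Λ ⊗[F] L} (hu : u ∈ homogeneous F V L p)
    (hv : v ∈ homogeneous F V L q) : u * v = -((-1 : F) ^ (p * q) • (v * u)) := by
  induction hu using homogeneous_induction with
  | zero => simp
  | add u₁ u₂ _ _ h₁ h₂ => rw [add_mul, h₁, h₂, mul_add]; module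
  | tmul x hx a =>
    induction hv using homogeneous_induction with
    | zero => simp
    | add v₁ v₂ _ _ h₁ h₂ => rw [mul_add, h₁, h₂, add_mul]; module
    | tmul y hy b =>
      rw [Algebra.TensorProduct.tmul_mul_tmul, Algebra.TensorProduct.tmul_mul_tmul,
        ExteriorAlgebra.mul_comm_of_mem_exteriorPower hx hy, mul_anticomm F a b,
        TensorProduct.tmul_neg, TensorProduct.smul_tmul']

theorem envelopeTriple_anticomm {p q : ℕ} {u v : Λ ⊗[F] L} (hu : u ∈ homogeneous F V L p)
    (hv : v ∈ homogeneous F V L q) (w : Λ ⊗[F] L) :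
    T u v w = -((-1 : F) ^ (p * q) • T v u w) := by
  induction hu using homogeneous_induction with
  | zero => simp
  | add u₁ u₂ _ _ h₁ h₂ => simp only [map_add, LinearMap.add_apply, h₁, h₂]; module
  | tmul x hx a =>
    induction hv using homogeneous_induction with
    | zero => simp
    | add v₁ v₂ _ _ h₁ h₂ => simp only [map_add, LinearMap.add_apply, h₁, h₂]; module
    | tmul y hy b =>
      induction w using TensorProduct.induction_on with
      | zero => simp
      | add w₁ w₂ h₁ h₂ => simp only [map_add, h₁, h₂]; module
      | tmul z c =>
        rw [envelopeTriple_tmul, envelopeTriple_tmul,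
          ExteriorAlgebra.mul_comm_of_mem_exteriorPower hx hy, triple_anticomm a b,
          TensorProduct.tmul_neg, TensorProduct.smul_tmul', smul_mul_assoc]

theorem exteriorPower_mul_rotate {p q r : ℕ} {x y z : Λ} (hx : x ∈ ⋀[F]^p V)
    (hy : y ∈ ⋀[F]^q V) (hz : z ∈ ⋀[F]^r V) :
    x * y * z = (-1 : F) ^ (p * (q + r)) • (y * z * x) := by
  rw [mul_assoc]
  exact ExteriorAlgebra.mul_comm_of_mem_exteriorPower hx
    (by unfold ExteriorAlgebra.exteriorPower; rw [pow_add]; exact Submodule.mul_mem_mul hy hz)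

theorem exteriorPower_mul_rotate' {p q r : ℕ} {x y z : Λ} (hx : x ∈ ⋀[F]^p V)
    (hy : y ∈ ⋀[F]^q V) (hz : z ∈ ⋀[F]^r V) :
    x * y * z = (-1 : F) ^ ((p + q) * r) • (z * x * y) := by
  rw [mul_assoc z]
  exact ExteriorAlgebra.mul_comm_of_mem_exteriorPower
    (by unfold ExteriorAlgebra.exteriorPower; rw [pow_add]; exact Submodule.mul_mem_mul hx hy) hz

theorem neg_one_pow_smul_smul {M : Type*} [AddCommGroup M] [Module F M] (n : ℕ) (m : M) :
    (-1 : F) ^ n • (-1 : F) ^ n • m = m := by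
  rw [smul_smul, ← mul_pow]; simp

theorem envelope_cyclic_mul_triple {p q r : ℕ} {u v w : Λ ⊗[F] L} (hu : u ∈ homogeneous F V L p)
    (hv : v ∈ homogeneous F V L q) (hw : w ∈ homogeneous F V L r) :
    (u * v * w + T u v w) + (-1 : F) ^ (p * (q + r)) • (v * w * u + T v w u)
      + (-1 : F) ^ ((p + q) * r) • (w * u * v + T w u v) = 0 := by
  induction hu using homogeneous_induction with
  | zero => simp
  | add u₁ u₂ _ _ h₁ h₂ =>
    simp only [map_add, LinearMap.add_apply, add_mul, mul_add]
    linear_combination (norm := module) h₁ + h₂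
  | tmul x hx a =>
    induction hv using homogeneous_induction with
    | zero => simp
    | add v₁ v₂ _ _ h₁ h₂ =>
      simp only [map_add, LinearMap.add_apply, add_mul, mul_add]
      linear_combination (norm := module) h₁ + h₂
    | tmul y hy b =>
      induction hw using homogeneous_induction with
      | zero => simp
      | add w₁ w₂ _ _ h₁ h₂ =>
        simp only [map_add, LinearMap.add_apply, add_mul, mul_add]
        linear_combination (norm := module) h₁ + h₂
      | tmul z hz c =>
        simp only [envelopeTriple_tmul, Algebra.TensorProduct.tmul_mul_tmul,
          ← TensorProduct.tmul_add, TensorProduct.smul_tmul']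
        rw [← exteriorPower_mul_rotate hx hy hz, ← exteriorPower_mul_rotate' hx hy hz,
          ← TensorProduct.tmul_add, ← TensorProduct.tmul_add, cyclic_bracket_triple,
          TensorProduct.tmul_zero]

theorem envelope_cyclic_triple {p q r : ℕ} {u v w : Λ ⊗[F] L} (hu : u ∈ homogeneous F V L p)
    (hv : v ∈ homogeneous F V L q) (hw : w ∈ homogeneous F V L r) (t : Λ ⊗[F] L) :
    T (u * v) w t + (-1 : F) ^ (p * (q + r)) • T (v * w) u t
      + (-1 : F) ^ ((p + q) * r) • T (w * u) v t = 0 := by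
  induction hu using homogeneous_induction with
  | zero => simp
  | add u₁ u₂ _ _ h₁ h₂ =>
    simp only [map_add, LinearMap.add_apply, add_mul, mul_add]
    linear_combination (norm := module) h₁ + h₂
  | tmul x hx a =>
    induction hv using homogeneous_induction with
    | zero => simp
    | add v₁ v₂ _ _ h₁ h₂ =>
      simp only [map_add, LinearMap.add_apply, add_mul, mul_add]
      linear_combination (norm := module) h₁ + h₂
    | tmul y hy b =>
      induction hw using homogeneous_induction with
      | zero => simp
      | add w₁ w₂ _ _ h₁ h₂ =>
        simp only [map_add, LinearMap.add_apply, add_mul, mul_add]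
        linear_combination (norm := module) h₁ + h₂
      | tmul z hz c =>
        induction t using TensorProduct.induction_on with
        | zero => simp
        | add t₁ t₂ h₁ h₂ =>
          simp only [map_add]
          linear_combination (norm := module) h₁ + h₂
        | tmul s d =>
          simp only [envelopeTriple_tmul, Algebra.TensorProduct.tmul_mul_tmul,
            TensorProduct.smul_tmul']
          rw [← smul_mul_assoc _ (y * z * x) s, ← smul_mul_assoc _ (z * x * y) s,
            ← exteriorPower_mul_rotate hx hy hz, ← exteriorPower_mul_rotate' hx hy hz,
            ← TensorProduct.tmul_add, ← TensorProduct.tmul_add, cyclic_triple_bracket,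
            TensorProduct.tmul_zero]

theorem envelopeTriple_mul {p q r : ℕ} {u v w : Λ ⊗[F] L} (hu : u ∈ homogeneous F V L p)
    (hv : v ∈ homogeneous F V L q) (hw : w ∈ homogeneous F V L r) (t : Λ ⊗[F] L) :
    T u v (w * t) = T u v w * t + (-1 : F) ^ ((p + q) * r) • (w * T u v t) := by
  induction hu using homogeneous_induction with
  | zero => simp
  | add u₁ u₂ _ _ h₁ h₂ =>
    simp only [map_add, LinearMap.add_apply, add_mul, mul_add, h₁, h₂]; module
  | tmul x hx a =>
    induction hv using homogeneous_induction with
    | zero => simp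
    | add v₁ v₂ _ _ h₁ h₂ =>
      simp only [map_add, LinearMap.add_apply, add_mul, mul_add, h₁, h₂]; module
    | tmul y hy b =>
      induction hw using homogeneous_induction with
      | zero => simp
      | add w₁ w₂ _ _ h₁ h₂ => simp only [map_add, add_mul, h₁, h₂]; module
      | tmul z hz c =>
        induction t using TensorProduct.induction_on with
        | zero => simp
        | add t₁ t₂ h₁ h₂ => simp only [map_add, mul_add, h₁, h₂]; module
        | tmul s d =>
          simp only [envelopeTriple_tmul, Algebra.TensorProduct.tmul_mul_tmul,
            TensorProduct.smul_tmul', triple_bracket, TensorProduct.tmul_add]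
          rw [← mul_assoc (x * y) z s, exteriorPower_mul_rotate' hx hy hz, smul_mul_assoc,
            ← mul_assoc z, ← mul_assoc z]

/-- The expression is cubic in `u` and vanishes on pure tensors because `a * a = 0`. Its mixed terms
in `u + v` form two cyclic sums, so no division by 3 occurs. -/
theorem envelopeTriple_mul_self_self {u : Λ ⊗[F] L} (hu : u ∈ homogeneous F V L 1)
    (t : Λ ⊗[F] L) : T (u * u) u t = 0 := by
  induction hu using homogeneous_induction with
  | zero => simp
  | tmul x hx a => simp [bracket_self (F := F)]
  | add u v hu hv hu' hv' =>
    have h₁ := envelope_cyclic_triple hu hu hv t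
    have h₂ := envelope_cyclic_triple hv hv hu t
    norm_num at h₁ h₂
    simp only [map_add, LinearMap.add_apply, add_mul, mul_add]
    linear_combination (norm := module) h₁ + h₂ + hu' + hv'

theorem isLieYamagutiSuper_envelope : IsLieYamagutiSuper (homogeneous F V L) T where
  mul_mem := mul_mem_homogeneous
  mul_anticomm := homogeneous_mul_anticomm
  triple_anticomm := envelopeTriple_anticomm
  cyclic_mul_triple := envelope_cyclic_mul_triple
  cyclic_triple := envelope_cyclic_triple
  triple_mul := envelopeTriple_mul
  triple_mul_self_self := envelopeTriple_mul_self_self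

end LieYamagutiAlgebra

/-! ### Alternating sums and the exterior algebra -/

namespace NonassocPolynomial

/-- `eightTerms` as a multilinear map. -/
def eightTermsMultilinear (F : Type u) (A : Type v) [Field F] [NonUnitalNonAssocRing A]
    [Module F A] [IsScalarTower F A A] [SMulCommClass F A A] :
    MultilinearMap F (fun _ : Fin 8 => A) A where
  toFun m := eightTerms F (m 0) (m 1) (m 2) (m 3) (m 4) (m 5) (m 6) (m 7)
  map_update_add' := by
    intro inst m i x y
    -- The field quantifies over all decidability instances; the canonical one lets `simp` evaluate
    -- `Function.update`.
    obtain rfl : inst = instDecidableEqFin 8 := Subsingleton.elim _ _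
    fin_cases i <;>
      simp [eightTerms, add_mul, mul_add, smul_add] <;> abel
  map_update_smul' := by
    intro inst m i c x
    obtain rfl : inst = instDecidableEqFin 8 := Subsingleton.elim _ _
    fin_cases i <;>
      simp [eightTerms, smul_mul_assoc, mul_smul_comm, smul_add, smul_sub,
        smul_comm c]

/-- All eight monomials carry their variables in the same order, so associativity gives them a
common exterior factor. -/
theorem eightTerms_tmul {F : Type u} {E : Type w} {A : Type v} [Field F] [Ring E] [Algebra F E]
    [NonUnitalNonAssocRing A] [Module F A] [IsScalarTower F A A] [SMulCommClass F A A]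
    (x : Fin 8 → E) (a : Fin 8 → A) :
    eightTerms F (x 0 ⊗ₜ[F] a 0) (x 1 ⊗ₜ[F] a 1) (x 2 ⊗ₜ[F] a 2) (x 3 ⊗ₜ[F] a 3)
      (x 4 ⊗ₜ[F] a 4) (x 5 ⊗ₜ[F] a 5) (x 6 ⊗ₜ[F] a 6) (x 7 ⊗ₜ[F] a 7) =
    (List.ofFn x).prod ⊗ₜ[F]
      eightTerms F (a 0) (a 1) (a 2) (a 3) (a 4) (a 5) (a 6) (a 7) := by
  simp only [eightTerms, Algebra.TensorProduct.tmul_mul_tmul, TensorProduct.tmul_add,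
    TensorProduct.tmul_sub, TensorProduct.tmul_smul, List.ofFn_succ, List.ofFn_zero,
    List.prod_cons, List.prod_nil, mul_one, mul_assoc]
  rfl

/-- The linear functional on the exterior algebra of `Fⁿ` which is the determinant in
degree `n`. -/
noncomputable def topCoefficient (F : Type u) [Field F] (n : ℕ) :
    ExteriorAlgebra F (Fin n → F) →ₗ[F] F :=
  ExteriorAlgebra.liftAlternating
    (Pi.single (M := fun i => (Fin n → F) [⋀^Fin i]→ₗ[F] F) n Matrix.detRowAlternating)

theorem topCoefficient_perm (F : Type u) [Field F] {n : ℕ} (σ : Equiv.Perm (Fin n)) :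
    topCoefficient F n
      (List.ofFn fun i => ExteriorAlgebra.ι F (Pi.single (σ i) (1 : F) : Fin n → F)).prod =
      ((Equiv.Perm.sign σ : ℤ) : F) := by
  have h := ExteriorAlgebra.liftAlternating_apply_ιMulti
    (Pi.single (M := fun i => (Fin n → F) [⋀^Fin i]→ₗ[F] F) n Matrix.detRowAlternating)
    (fun i => (Pi.single (σ i) (1 : F) : Fin n → F))
  rw [ExteriorAlgebra.ιMulti_apply, Pi.single_eq_same] at h
  rw [topCoefficient, h]
  have h' := (Matrix.detRowAlternating (R := F) (n := Fin n)).map_perm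
    (fun i => (Pi.single i (1 : F) : Fin n → F)) σ
  refine h'.trans ?_
  have h₁ : (Matrix.detRowAlternating (R := F) (n := Fin n))
      (fun i => (Pi.single i (1 : F) : Fin n → F)) = 1 := by
    have h₂ : (fun i => (Pi.single i (1 : F) : Fin n → F)) = (1 : Matrix (Fin n) (Fin n) F) := by
      ext i j
      simp [Matrix.one_apply, Pi.single_apply, eq_comm]
    rw [h₂]
    exact Matrix.det_one
  rw [h₁, Units.smul_def, zsmul_eq_mul, mul_one]

theorem prod_ι_eq_zero_of_not_injective (F : Type u) [Field F] {n : ℕ} {r : Fin n → Fin n}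
    (hr : ¬ Function.Injective r) :
    (List.ofFn fun i => ExteriorAlgebra.ι F (Pi.single (r i) (1 : F) : Fin n → F)).prod = 0 := by
  rw [← ExteriorAlgebra.ιMulti_apply]
  refine AlternatingMap.map_eq_zero_of_not_injective _ _ fun h => hr fun i j hij => h ?_
  simp only [hij]

/-- Multilinear expansion gives a sum over all maps `r : Fin 8 → Fin 8`. A repeated index kills the
exterior factor, and a permutation contributes its sign. -/
theorem sum_sign_smul_eightTerms {F : Type u} {A : Type v} [Field F]
    [NonUnitalNonAssocRing A] [Module F A] [IsScalarTower F A A] [SMulCommClass F A A]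
    (a : Fin 8 → A) {x : ExteriorAlgebra F (Fin 8 → F) ⊗[F] A}
    (hx : x = ∑ i, ExteriorAlgebra.ι F (Pi.single i (1 : F)) ⊗ₜ[F] a i) :
    ∑ σ : Equiv.Perm (Fin 8), ((Equiv.Perm.sign σ : ℤ) : F) •
      eightTerms F (a (σ 0)) (a (σ 1)) (a (σ 2)) (a (σ 3)) (a (σ 4)) (a (σ 5)) (a (σ 6))
        (a (σ 7)) =
    TensorProduct.lid F A ((topCoefficient F 8).rTensor A (eightTerms F x x x x x x x x)) := by
  have h := (eightTermsMultilinear F (ExteriorAlgebra F (Fin 8 → F) ⊗[F] A)).map_sum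
    (fun _ i => ExteriorAlgebra.ι F (Pi.single i (1 : F)) ⊗ₜ[F] a i)
  simp only [← hx] at h
  have h' : eightTerms F x x x x x x x x = ∑ r : Fin 8 → Fin 8,
      (List.ofFn fun i => ExteriorAlgebra.ι F (Pi.single (r i) (1 : F) : Fin 8 → F)).prod ⊗ₜ[F]
        eightTerms F (a (r 0)) (a (r 1)) (a (r 2)) (a (r 3)) (a (r 4)) (a (r 5)) (a (r 6))
          (a (r 7)) :=
    h.trans (Finset.sum_congr rfl fun r _ => eightTerms_tmul
      (fun i => ExteriorAlgebra.ι F (Pi.single (r i) (1 : F) : Fin 8 → F)) (fun i => a (r i)))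
  rw [h', map_sum, map_sum]
  refine Finset.sum_of_injOn (fun σ i => σ i) (fun σ _ τ _ h => Equiv.ext (congrFun h))
    (fun _ _ => Finset.mem_coe.2 (Finset.mem_univ _)) (fun r _ hr => ?_) (fun σ _ => ?_)
  · have hr' : ¬ Function.Injective r := fun hi => hr
      ⟨Equiv.ofBijective r (Finite.injective_iff_bijective.1 hi), by simp, rfl⟩
    rw [prod_ι_eq_zero_of_not_injective F hr', TensorProduct.zero_tmul, map_zero, map_zero]
  · rw [LinearMap.rTensor_tmul, TensorProduct.lid_tmul, topCoefficient_perm]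

theorem map_eightTerms {F : Type u} {A B : Type*} [Field F] [NonUnitalNonAssocRing A] [Module F A]
    [NonUnitalNonAssocRing B] [Module F B] (φ : A →ₙₐ[F] B) (a b c d e f g h : A) :
    φ (eightTerms F a b c d e f g h) =
      eightTerms F (φ a) (φ b) (φ c) (φ d) (φ e) (φ f) (φ g) (φ h) := by
  simp only [eightTerms, map_add, map_sub, map_smul, map_mul]

theorem lift_degreeEight {F : Type u} {A : Type v} [Field F] [NonUnitalNonAssocRing A] [Module F A]
    [IsScalarTower F A A] [SMulCommClass F A A] (a : ℕ → A) :
    FreeNonUnitalNonAssocAlgebra.lift F a (degreeEight F) =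
      ∑ σ : Equiv.Perm (Fin 8), ((Equiv.Perm.sign σ : ℤ) : F) •
        eightTerms F (a (σ 0)) (a (σ 1)) (a (σ 2)) (a (σ 3)) (a (σ 4)) (a (σ 5)) (a (σ 6))
          (a (σ 7)) := by
  simp only [degreeEight, map_sum, map_smul, map_eightTerms,
    FreeNonUnitalNonAssocAlgebra.lift_of_apply]

theorem isIdentity_degreeEight {F : Type u} {L : Type v} [Field F] [NonUnitalNonAssocRing L]
    [Module F L] [IsScalarTower F L L] [SMulCommClass F L L] [LieYamagutiAlgebra F L]
    (h2 : (2 : F) ≠ 0) : IsIdentity F L (degreeEight F) := by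
  intro a
  rw [lift_degreeEight, sum_sign_smul_eightTerms (fun i : Fin 8 => a i) rfl,
    (LieYamagutiAlgebra.isLieYamagutiSuper_envelope (F := F) (V := Fin 8 → F)
      (L := L)).eightTerms_eq_zero h2, map_zero, map_zero]
  refine sum_mem fun i _ => LieYamagutiAlgebra.tmul_mem_homogeneous ?_ _
  rw [ExteriorAlgebra.exteriorPower, pow_one]
  exact LinearMap.mem_range_self _ _

/-! ### An anticommutative algebra in which the identity of degree eight fails -/

/-- The identities of a fixed algebra form a T-ideal; stability under substitution holds because
evaluation after substitution is again an evaluation. -/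
theorem isIdentity_of_isConsequence {F : Type u} [Field F] {A : Type v} [NonUnitalNonAssocRing A]
    [Module F A] [IsScalarTower F A A] [SMulCommClass F A A] {X : Type w}
    {S : Set (FreeNonUnitalNonAssocAlgebra F X)} (hS : ∀ f ∈ S, IsIdentity F A f)
    {f : FreeNonUnitalNonAssocAlgebra F X} (hf : IsConsequence F S f) : IsIdentity F A f := by
  induction hf with
  | of_mem h => exact hS _ h
  | zero => exact fun a => map_zero _
  | add _ _ h₁ h₂ => exact fun a => by rw [map_add, h₁ a, h₂ a, add_zero]
  | smul c _ h => exact fun a => by rw [map_smul, h a, smul_zero]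
  | mul_left g _ h => exact fun a => by rw [map_mul, h a, mul_zero]
  | mul_right g _ h => exact fun a => by rw [map_mul, h a, zero_mul]
  | @subst s f _ h =>
    intro a
    have h' : (FreeNonUnitalNonAssocAlgebra.lift F a).comp (FreeNonUnitalNonAssocAlgebra.lift F s) =
        FreeNonUnitalNonAssocAlgebra.lift F
          (fun i => FreeNonUnitalNonAssocAlgebra.lift F a (s i)) := by
      refine FreeNonUnitalNonAssocAlgebra.hom_ext F fun i => ?_
      simp only [NonUnitalAlgHom.comp_apply,
        FreeNonUnitalNonAssocAlgebra.lift_of_apply]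
    exact (DFunLike.congr_fun h' f).trans (h _)

/-- The vector space `F¹⁵`, with basis `b₀, …, b₁₄`, as the underlying space of an anticommutative
algebra in which `((b₀b₁)b₂)(b₃b₄) · (b₅b₆)b₇ = b₁₄`. -/
def WitnessAlgebra (F : Type u) : Type u := Fin 15 → F

namespace WitnessAlgebra

variable (F : Type u) [Field F]

noncomputable instance : AddCommGroup (WitnessAlgebra F) :=
  inferInstanceAs (AddCommGroup (Fin 15 → F))

noncomputable instance : Module F (WitnessAlgebra F) :=
  inferInstanceAs (Module F (Fin 15 → F))

/-- The basis vector `b_k` with `k ≥ 8` is the product of the basis vectors with indices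
`leftFactor k` and `rightFactor k`. -/
def leftFactor : Fin 15 → Fin 15 := ![0, 0, 0, 0, 0, 0, 0, 0, 0, 8, 3, 9, 5, 12, 11]

/-- See `leftFactor`. -/
def rightFactor : Fin 15 → Fin 15 := ![0, 0, 0, 0, 0, 0, 0, 0, 1, 2, 4, 10, 6, 7, 13]

-- For `k < 8` both factor indices are the default `0`, so the two terms cancel and products have no
-- component along `b₀, …, b₇`.
instance : Mul (WitnessAlgebra F) where
  mul p q := fun k =>
    p (leftFactor k) * q (rightFactor k) - p (rightFactor k) * q (leftFactor k)

variable {F}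

theorem mul_apply (p q : WitnessAlgebra F) (k : Fin 15) : (p * q) k =
    p (leftFactor k) * q (rightFactor k) - p (rightFactor k) * q (leftFactor k) := rfl

theorem add_apply (p q : WitnessAlgebra F) (k : Fin 15) : (p + q) k = p k + q k := rfl

theorem sub_apply (p q : WitnessAlgebra F) (k : Fin 15) : (p - q) k = p k - q k := rfl

theorem smul_apply (c : F) (p : WitnessAlgebra F) (k : Fin 15) : (c • p) k = c * p k := rfl

theorem zero_apply (k : Fin 15) : (0 : WitnessAlgebra F) k = 0 := rfl

noncomputable instance : NonUnitalNonAssocRing (WitnessAlgebra F) where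
  left_distrib p q r := funext fun k => by simp only [mul_apply, add_apply]; ring
  right_distrib p q r := funext fun k => by simp only [mul_apply, add_apply]; ring
  zero_mul p := funext fun k => by simp only [mul_apply, zero_apply]; ring
  mul_zero p := funext fun k => by simp only [mul_apply, zero_apply]; ring

instance : IsScalarTower F (WitnessAlgebra F) (WitnessAlgebra F) where
  smul_assoc c p q := funext fun k => by
    simp only [smul_eq_mul, mul_apply, smul_apply]; ring

instance : SMulCommClass F (WitnessAlgebra F) (WitnessAlgebra F) where
  smul_comm c p q := funext fun k => by
    simp only [smul_eq_mul, mul_apply, smul_apply]; ring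

theorem mul_self (p : WitnessAlgebra F) : p * p = 0 :=
  funext fun k => by rw [mul_apply, mul_comm, sub_self]; rfl

/-- Coordinate 14 requires the tree `((b₀b₁)b₂)(b₃b₄) · (b₅b₆)b₇`; the other seven monomials have
different shapes and contribute nothing. -/
theorem eightTerms_apply {p : Fin 8 → WitnessAlgebra F}
    (hp : ∀ i, ∀ k : Fin 15, 8 ≤ k → p i k = 0) :
    eightTerms F (p 0) (p 1) (p 2) (p 3) (p 4) (p 5) (p 6) (p 7) 14 =
      (p 0 0 * p 1 1 - p 0 1 * p 1 0) * p 2 2 * (p 3 3 * p 4 4 - p 3 4 * p 4 3) *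
        ((p 5 5 * p 6 6 - p 5 6 * p 6 5) * p 7 7) := by
  have h (i : Fin 8) : p i 8 = 0 ∧ p i 9 = 0 ∧ p i 10 = 0 ∧ p i 11 = 0 ∧ p i 12 = 0 ∧
      p i 13 = 0 ∧ p i 14 = 0 := by
    refine ⟨?_, ?_, ?_, ?_, ?_, ?_, ?_⟩ <;> exact hp i _ (by decide)
  simp [eightTerms, add_apply, sub_apply, smul_apply, mul_apply, leftFactor, rightFactor, h]

/-- A coordinate as a linear functional. -/
def coordinate (F : Type u) [Field F] (k : Fin 15) : WitnessAlgebra F →ₗ[F] F :=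
  LinearMap.proj (φ := fun _ : Fin 15 => F) k

/-- The first eight basis vectors. -/
def basisVector (F : Type u) [Field F] (i : Fin 8) : WitnessAlgebra F :=
  fun k => if Fin.castLE (by decide) i = k then 1 else 0

theorem sum_sign_mul_prod_single {n : ℕ} (τ : Equiv.Perm (Fin n)) :
    ∑ σ : Equiv.Perm (Fin n), ((Equiv.Perm.sign σ : ℤ) : F) *
      ∏ i, (Pi.single (σ i) 1 : Fin n → F) (τ i) = ((Equiv.Perm.sign τ : ℤ) : F) := by
  rw [Finset.sum_eq_single τ (fun σ _ hσ => ?_) (fun h => absurd (Finset.mem_univ τ) h)]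
  · simp
  · obtain ⟨i, hi⟩ : ∃ i, σ i ≠ τ i := by
      by_contra! h
      exact hσ (Equiv.ext h)
    rw [Finset.prod_eq_zero (Finset.mem_univ i) (Pi.single_eq_of_ne hi.symm _), mul_zero]

/-- The products of some of the transpositions `(0 1)`, `(3 4)`, `(5 6)`. -/
def swaps (j : Fin 2 × Fin 2 × Fin 2) : Equiv.Perm (Fin 8) :=
  Equiv.swap 0 1 ^ (j.1 : ℕ) * Equiv.swap 3 4 ^ (j.2.1 : ℕ) * Equiv.swap 5 6 ^ (j.2.2 : ℕ)

/-- The three `2 × 2` minors in `eightTerms_apply` expand into eight signed products, indexed by the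
swaps of the sibling leaves. -/
theorem eightTerms_basisVector (σ : Equiv.Perm (Fin 8)) :
    eightTerms F (basisVector F (σ 0)) (basisVector F (σ 1)) (basisVector F (σ 2))
      (basisVector F (σ 3)) (basisVector F (σ 4)) (basisVector F (σ 5)) (basisVector F (σ 6))
      (basisVector F (σ 7)) 14 =
    ∑ j, ((Equiv.Perm.sign (swaps j) : ℤ) : F) *
      ∏ i, (Pi.single (σ i) 1 : Fin 8 → F) (swaps j i) := by
  have hb (i j : Fin 8) :
      basisVector F i (Fin.castLE (by decide) j) =
      (Pi.single i 1 : Fin 8 → F) j := by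
    simp only [basisVector, Fin.castLE_inj, Pi.single_apply, eq_comm]
  have h := eightTerms_apply (p := fun i => basisVector F (σ i)) fun i k hk =>
    if_neg fun h => by
      have := congrArg Fin.val h
      have := Fin.le_def.1 hk
      simp at *
      omega
  refine h.trans ?_
  have b0 (i : Fin 8) : basisVector F i 0 = (Pi.single i 1 : Fin 8 → F) 0 := hb i 0
  have b1 (i : Fin 8) : basisVector F i 1 = (Pi.single i 1 : Fin 8 → F) 1 := hb i 1
  have b2 (i : Fin 8) : basisVector F i 2 = (Pi.single i 1 : Fin 8 → F) 2 := hb i 2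
  have b3 (i : Fin 8) : basisVector F i 3 = (Pi.single i 1 : Fin 8 → F) 3 := hb i 3
  have b4 (i : Fin 8) : basisVector F i 4 = (Pi.single i 1 : Fin 8 → F) 4 := hb i 4
  have b5 (i : Fin 8) : basisVector F i 5 = (Pi.single i 1 : Fin 8 → F) 5 := hb i 5
  have b6 (i : Fin 8) : basisVector F i 6 = (Pi.single i 1 : Fin 8 → F) 6 := hb i 6
  have b7 (i : Fin 8) : basisVector F i 7 = (Pi.single i 1 : Fin 8 → F) 7 := hb i 7
  simp only [b0, b1, b2, b3, b4, b5, b6, b7, swaps, Fintype.sum_prod_type, Fin.sum_univ_two,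
    Fin.prod_univ_eight, Fin.val_zero, Fin.val_one, pow_zero, pow_one, one_mul, mul_one]
  simp only [Equiv.Perm.sign_mul, Equiv.Perm.sign_one, Equiv.Perm.coe_mul, Equiv.Perm.coe_one,
    Function.comp_apply, id_eq, Equiv.swap_apply_def, Fin.reduceEq, if_true, if_false,
    Equiv.Perm.sign_swap', Units.val_mul, Units.val_neg, Units.val_one, Int.cast_neg,
    Int.cast_one, Int.cast_mul]
  ring

theorem not_isIdentity_degreeEight (h2 : (2 : F) ≠ 0) :
    ¬ IsIdentity F (WitnessAlgebra F) (degreeEight F) := by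
  intro h
  have h₁ := (lift_degreeEight _).symm.trans
    (h fun i => if hi : i < 8 then basisVector F ⟨i, hi⟩ else 0)
  simp only [Fin.is_lt, dite_true, Fin.eta] at h₁
  have h₂ := congrArg (coordinate F 14) h₁
  rw [map_sum, map_zero] at h₂
  have h₃ : ∑ σ : Equiv.Perm (Fin 8), ((Equiv.Perm.sign σ : ℤ) : F) *
      eightTerms F (basisVector F (σ 0)) (basisVector F (σ 1)) (basisVector F (σ 2))
        (basisVector F (σ 3)) (basisVector F (σ 4)) (basisVector F (σ 5)) (basisVector F (σ 6))
        (basisVector F (σ 7)) 14 = 0 := h₂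
  have h₄ (τ : Equiv.Perm (Fin 8)) :
      ((Equiv.Perm.sign τ : ℤ) : F) * ((Equiv.Perm.sign τ : ℤ) : F) = 1 := by
    rw [← Int.cast_mul, ← Units.val_mul, Int.units_mul_self, Units.val_one, Int.cast_one]
  have h₅ (j) : ∑ σ : Equiv.Perm (Fin 8), ((Equiv.Perm.sign σ : ℤ) : F) *
      (((Equiv.Perm.sign (swaps j) : ℤ) : F) *
        ∏ i, (Pi.single (σ i) 1 : Fin 8 → F) (swaps j i)) = 1 := by
    -- Only `σ = swaps j` survives, and its sign occurs squared.
    refine Eq.trans ?_ (h₄ (swaps j))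
    nth_rewrite 3 [← sum_sign_mul_prod_single (swaps j)]
    rw [Finset.mul_sum]
    exact Finset.sum_congr rfl fun σ _ => mul_left_comm _ _ _
  simp only [eightTerms_basisVector, Finset.mul_sum] at h₃
  rw [Finset.sum_comm] at h₃
  simp only [h₅, Finset.sum_const, Finset.card_univ, Fintype.card_prod, Fintype.card_fin,
    nsmul_eq_mul, mul_one] at h₃
  -- The eight choices of `j` contribute 1 each, so `h₃` says `8 = 2 ^ 3` is zero in `F`.
  exact pow_ne_zero 3 h2 (by rw [← h₃]; norm_num)

end WitnessAlgebra

theorem not_isConsequence_degreeEight {F : Type u} [Field F] (h2 : (2 : F) ≠ 0) :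
    ¬ IsConsequence F {anticommutativity F} (degreeEight F) := by
  refine fun h => WitnessAlgebra.not_isIdentity_degreeEight h2
    (isIdentity_of_isConsequence (fun f hf a => ?_) h)
  rw [Set.mem_singleton_iff.1 hf, anticommutativity, map_mul, WitnessAlgebra.mul_self]

end NonassocPolynomial

theorem mainTheorem1 (F : Type u) [Field F] (hF : ringChar F = 0 ∨ 2 < ringChar F) :
    (∀ (L : Type v) [NonUnitalNonAssocRing L] [Module F L] [IsScalarTower F L L]
        [SMulCommClass F L L] [LieYamagutiAlgebra F L],
        NonassocPolynomial.IsIdentity F L (NonassocPolynomial.degreeEight F)) ∧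
      ¬ NonassocPolynomial.IsConsequence F {NonassocPolynomial.anticommutativity F}
          (NonassocPolynomial.degreeEight F) := by
  have h2 : (2 : F) ≠ 0 := Ring.two_ne_zero (by omega)
  exact ⟨fun L => NonassocPolynomial.isIdentity_degreeEight h2,
    NonassocPolynomial.not_isConsequence_degreeEight h2⟩
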